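/- Let $Q$ be a full conjunctive query with variables $x_1,\dots,x_n$, numbered along a key order $\pi$, such that every body atom has at least one argument and its argument list is a subsequence of $x_1,\dots,x_n$. The rank $\ell=r_\pi(Q)$ is the largest $i$ such that $x_i$ is the first variable of some atom. Let $I$ assign a finite relation to every relation symbol of $Q$, let $|I|$ be the total number of tuples of these relations, and let $K$ be the number of output tuples. The relations are stored on disk as TrieArrays (the levels of the sorted trie in value arrays, with index arrays that point to the children), in blocks of $B$ words. The main memory has $M\ge B$ words, of which $m_{\max}$ blocks are used for slices, where $\gamma M\le m_{\max}B\le M$ for a constant $\gamma>0$; constant-size buffers and counters are not charged to these blocks. Reading or writing one block costs one I/O. Boxed Leapfrog Triejoin processes the dimensions $i=1,\dots,n$ recursively. Dimension $i$ has the budget $\lfloor m_{\max}/n\rfloor$ plus what the slices of dimension $i-1$ leave over, divided evenly among the atoms with first variable $x_i$. Starting with the lower bound $l=-\infty$, it repeats the following. It probes each of these atoms for the largest $h\ge l$ such that the slice of the relation with first attribute in $[l,h]$ fits the atom's share (by binary search among the values, starting at $l$, that could fit the share, following the index arrays to find the size of a slice). It takes the minimum of these bounds $h$ (or $\infty$ if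 there is no atom), loads the slices for $[l,h]$, runs the next dimension (after the last one, the join is run in memory on the current box, and the result is appended to the output through a one-block buffer), and continues with $l=h+1$, until $h=\infty$. The position where a slice ends is remembered as the start of the next one, and a block is read at most once within one probe or one load. A probe spills if already the slice for $[l,l]$ does not fit. Then for all constants $\gamma,\delta>0$ there is a constant $C$, depending only on $Q$ (with $\pi$), $\gamma$ and $\delta$, such that the following holds for all $B\ge1$, $M\ge B$, all $m_{\max}$ with $\gamma M\le m_{\max}B\le M$, and all inputs $I$ with $|I|\ge\delta M$: if no spill occurs in the run of boxed Leapfrog Triejoin for $Q$ with key order $\pi$ on $I$, then the total number of block I/Os (reads for probing and loading, and writes of the output) is at most $$C\left(\frac{|I|^{\ell}}{M^{\ell-1}B}+\frac{K}{B}\right).$$ -/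

import Mathlib

open Finset

/-! ### Queries -/

/-- A full conjunctive query conforming to a key order.  The variables are named by their position
`0, …, n - 1` in the key order.  Atom `j` refers to the relation symbol `rel j`, and its argument
list `vars j` is a subsequence of the key order (in particular no variable is repeated). -/
structure JoinQuery where
  /-- number of variables -/
  n : ℕ
  /-- number of relation symbols -/
  numRel : ℕ
  /-- arities of the relation symbols -/
  arity : Fin numRel → ℕ
  arity_pos : ∀ r, 0 < arity r
  /-- number of body atoms -/
  m : ℕ
  /-- relation symbol of each atom -/
  rel : Fin m → Fin numRel
  /-- argument variables of each atom -/
  vars : ∀ j, Fin (arity (rel j)) → Fin n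
  vars_strictMono : ∀ j, StrictMono (vars j)
  /-- the relation symbols are those that the body mentions -/
  rel_surjective : Function.Surjective rel
  /-- the variables are those that the body mentions -/
  vars_cover : ∀ x, ∃ j k, vars j k = x

namespace JoinQuery

/-- An input: one finite relation for each relation symbol.  Atomic values are integers. -/
abbrev Input (Q : JoinQuery) : Type := ∀ r, Finset (Fin (Q.arity r) → ℤ)

/-- The combined size `|I|` of the input relations. -/
def inputSize (Q : JoinQuery) (I : Q.Input) : ℕ := ∑ r, #(I r)

/-- The output relation: all assignments of the variables that satisfy every atom. -/
def output (Q : JoinQuery) (I : Q.Input) : Set (Fin Q.n → ℤ) :=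
  {x | ∀ j, (fun k => x (Q.vars j k)) ∈ I (Q.rel j)}

/-- The output size `K`. -/
noncomputable def outputSize (Q : JoinQuery) (I : Q.Input) : ℕ := (Q.output I).ncard

/-- The first variable of an atom. -/
def firstVar (Q : JoinQuery) (j : Fin Q.m) : Fin Q.n := Q.vars j ⟨0, Q.arity_pos _⟩

/-- The atoms whose first variable is the variable at position `i` (counted from `0`). -/
def preds (Q : JoinQuery) (i : ℕ) : Finset (Fin Q.m) := {j | (Q.firstVar j : ℕ) = i}

/-- The rank: the largest index (counted from `1`) of a variable that is the first variable of
some atom. -/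
def rank (Q : JoinQuery) : ℕ := univ.sup fun j => (Q.firstVar j : ℕ) + 1

end JoinQuery

/-! ### TrieArrays -/

/-- A TrieArray: value arrays `val 0, …, val (arity - 1)` and index arrays
`idx 0, …, idx (arity - 2)`.  The children of the node at position `p` of `val k` are the entries of
`val (k + 1)` at the positions from `(idx k)[p]` to `(idx k)[p + 1]`, the latter excluded. -/
structure TrieArray where
  /-- height of the trie -/
  arity : ℕ
  /-- value arrays -/
  val : ℕ → List ℤ
  /-- index arrays -/
  idx : ℕ → List ℕ

/-- The trie nodes at level `k`, each given by the path that leads to it. -/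
def trieNodes {a : ℕ} (R : Finset (Fin a → ℤ)) (k : ℕ) : Finset (List ℤ) :=
  R.image fun t => (List.ofFn t).take (k + 1)

/-- The nodes of level `k` in lexicographic order. -/
def trieLevel {a : ℕ} (R : Finset (Fin a → ℤ)) (k : ℕ) : List (List ℤ) :=
  (trieNodes R k).sort (· ≤ ·)

/-- The number of children of the node `u` of level `k`. -/
def trieChildren {a : ℕ} (R : Finset (Fin a → ℤ)) (k : ℕ) (u : List ℤ) : ℕ :=
  #{w ∈ trieNodes R (k + 1) | w.take (k + 1) = u}

/-- The TrieArray of a relation. -/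
def TrieArray.ofRel {a : ℕ} (R : Finset (Fin a → ℤ)) : TrieArray where
  arity := a
  val k := (trieLevel R k).map fun u => u.getLastD 0
  idx k := (List.range ((trieLevel R k).length + 1)).map fun p =>
    (((trieLevel R k).take p).map (trieChildren R k)).sum

/-- A block on secondary storage: the kind of array (`false` for value arrays, `true` for index
arrays), the level of the array, and the number of the block within the array.  Every array starts
at a block boundary, and a block holds `B` consecutive entries. -/
abbrev Block : Type := Bool × ℕ × ℕ

/-- The block that holds entry `p` of `val k`. -/
def valBlock (B k p : ℕ) : Block := (false, k, p / B)

/-- The block that holds entry `p` of `idx k`. -/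
def idxBlock (B k p : ℕ) : Block := (true, k, p / B)

/-- Binary search between `lo` and `hi` for the last position where the monotone test `P` succeeds
(`P lo` is known to hold), together with the list of the positions that are tested. -/
def bisect (P : ℕ → Bool) (lo hi : ℕ) : ℕ × List ℕ :=
  if lo < hi then
    let mid := (lo + hi + 1) / 2
    let r := if P mid then bisect P mid hi else bisect P lo (mid - 1)
    (r.1, mid :: r.2)
  else (lo, [])
termination_by hi - lo
decreasing_by all_goals omega

namespace TrieArray

/-- Length of the array `val 0`. -/
def len (T : TrieArray) : ℕ := (T.val 0).length

/-- Entry `p` of `val 0`. -/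
def key (T : TrieArray) (p : ℕ) : ℤ := (T.val 0).getD p 0

/-- The position in `val k` at which the descendants of the nodes at positions `≥ p` of `val 0`
start; it is found by following the index arrays. -/
def cut (T : TrieArray) (p : ℕ) : ℕ → ℕ
  | 0 => p
  | k + 1 => (T.idx k).getD (T.cut p k) 0

/-- Size in words of the TrieArray of the slice that consists of the positions `s, …, e - 1` of
`val 0` and everything below them: `arity` value arrays, and `arity - 1` index arrays with one
more entry. -/
def sliceWords (T : TrieArray) (s e : ℕ) : ℕ :=
  if s < e then
    ∑ k ∈ range T.arity, (T.cut e k - T.cut s k) +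
      ∑ k ∈ range (T.arity - 1), (T.cut e k - T.cut s k + 1)
  else 0

/-- The number of blocks of main memory that this slice occupies. -/
def sliceBlocks (T : TrieArray) (B s e : ℕ) : ℕ := (T.sliceWords s e + B - 1) / B

/-! Probing from position `s` with a budget of `b` blocks: a binary search for the largest `q` such
that the slice of the positions `s, …, q - 1` occupies at most `b` blocks.  Such a slice has at most
`b * B` values, which limits the range of the search. -/

/-- The binary search of a probe. -/
def probeSearch (T : TrieArray) (B s b : ℕ) : ℕ × List ℕ :=
  bisect (fun q => decide (T.sliceBlocks B s q ≤ b)) s (min T.len (s + b * B))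

/-- The position at which the largest slice that fits the budget ends. -/
def probeEnd (T : TrieArray) (B s b : ℕ) : ℕ := (T.probeSearch B s b).1

/-- The upper bound that the probe reports: the largest `h` such that the slice up to the value `h`
fits the budget (values form the discrete order `ℤ`). -/
def probeHigh (T : TrieArray) (B s b : ℕ) : WithTop ℤ :=
  if T.probeEnd B s b < T.len then ((T.key (T.probeEnd B s b) - 1 : ℤ) : WithTop ℤ) else ⊤

/-- The probe from the lower bound `low` (where `s` is the position of the first value `≥ low`)
reports `SPILL`: already the slice from `low` to `low` exceeds the budget. -/
def Spill (T : TrieArray) (B s b : ℕ) (low : WithBot ℤ) : Prop :=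
  T.probeEnd B s b < T.len ∧ ((T.key (T.probeEnd B s b) : ℤ) : WithBot ℤ) ≤ low

/-- The blocks read by a probe.  To find the size of the slice that ends at `q`, the index arrays
are followed from `q` downwards, until a level exceeds the budget by itself, or the lowest level is
reached.  At the end, the value that bounds the slice is looked up.  A block is counted once per
probe: of each array the search only has to keep in memory the blocks of the two current ends of
its range, because all later tests lie between them. -/
def probeReads (T : TrieArray) (B s b : ℕ) : Finset Block :=
  ((s :: (T.probeSearch B s b).2).toFinset.biUnion fun q =>
      {k ∈ range (T.arity - 1) | T.cut q k - T.cut s k ≤ b * B}.image fun k =>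
        idxBlock B k (T.cut q k)) ∪
    if T.probeEnd B s b < T.len then {valBlock B 0 (T.probeEnd B s b)} else ∅

/-! Provisioning the slice that starts at position `s` and contains the values up to `high`, where
`q` is the position at which the probed slice ends. -/

/-- The binary search in `val 0` for the position at which the slice ends. -/
noncomputable def provisionSearch (T : TrieArray) (s q : ℕ) (high : WithTop ℤ) : ℕ × List ℕ :=
  bisect (fun p => decide ((T.key (p - 1) : WithTop ℤ) ≤ high)) s q

/-- The position at which the slice ends. -/
noncomputable def provisionEnd (T : TrieArray) (s q : ℕ) (high : WithTop ℤ) : ℕ := (T.provisionSearch s q high).1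

/-- The blocks read to provision the slice: those of the binary search, and those that hold the
sub-arrays which are copied into main memory. -/
noncomputable def provisionReads (T : TrieArray) (B s q : ℕ) (high : WithTop ℤ) : Finset Block :=
  let e := T.provisionEnd s q high
  ((T.provisionSearch s q high).2.toFinset.image fun p => valBlock B 0 (p - 1)) ∪
    ((range T.arity).biUnion fun k => (Ico (T.cut s k) (T.cut e k)).image (valBlock B k)) ∪
    (range (T.arity - 1)).biUnion fun k => (Icc (T.cut s k) (T.cut e k)).image (idxBlock B k)

end TrieArray

/-! ### Boxed Leapfrog Triejoin -/

/-- What a (part of a) run does: the number of blocks read, and the number of output tuples that are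
produced. -/
structure RunCost where
  reads : ℕ
  tuples : ℕ

/-- The slice of `R` (at level `0`) from `low` to `high`. -/
def relSlice {a : ℕ} (ha : 0 < a) (R : Finset (Fin a → ℤ)) (low : WithBot ℤ) (high : WithTop ℤ) :
    Finset (Fin a → ℤ) :=
  {t ∈ R | low ≤ (t ⟨0, ha⟩ : WithBot ℤ) ∧ (t ⟨0, ha⟩ : WithTop ℤ) ≤ high}

namespace JoinQuery

/-- The TrieArray of an atom. -/
def trie (Q : JoinQuery) (I : Q.Input) (j : Fin Q.m) : TrieArray := TrieArray.ofRel (I (Q.rel j))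

/-- The tuples that the in-memory join finds in the box `[low, high]`, run on the slices that were
provisioned for this box. -/
def boxOutput (Q : JoinQuery) (I : Q.Input) (low : ℕ → WithBot ℤ) (high : ℕ → WithTop ℤ) :
    Set (Fin Q.n → ℤ) :=
  {x | (∀ i : Fin Q.n, low i ≤ (x i : WithBot ℤ) ∧ (x i : WithTop ℤ) ≤ high i) ∧
    ∀ j, (fun k => x (Q.vars j k)) ∈
      relSlice (Q.arity_pos _) (I (Q.rel j)) (low (Q.firstVar j)) (high (Q.firstVar j))}

/-- The common upper bound in dimension `i`, when every atom of this dimension is probed from its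
position `pos j` with a budget of `b` blocks. -/
def high (Q : JoinQuery) (I : Q.Input) (B i b : ℕ) (pos : Fin Q.m → ℕ) : WithTop ℤ :=
  (Q.preds i).inf fun j => (Q.trie I j).probeHigh B (pos j) b

/-- All first-column values of the atoms; only used to see that the loop terminates. -/
def allKeys (Q : JoinQuery) (I : Q.Input) : Finset ℤ :=
  univ.biUnion fun j => ((Q.trie I j).val 0).toFinset

theorem loop_decreasing (Q : JoinQuery) (I : Q.Input) (B i b : ℕ) (pos : Fin Q.m → ℕ)
    (low : WithBot ℤ) (hs : ¬ ∃ j ∈ Q.preds i, (Q.trie I j).Spill B (pos j) b low) (h : ℤ)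
    (hh : Q.high I B i b pos = (h : WithTop ℤ)) :
    #{v ∈ Q.allKeys I | ((h + 1 : ℤ) : WithBot ℤ) < ((v : ℤ) : WithBot ℤ)} <
      #{v ∈ Q.allKeys I | low < ((v : ℤ) : WithBot ℤ)} := by
  have hne : (Q.preds i).Nonempty := by
    by_contra hne
    rw [not_nonempty_iff_eq_empty] at hne
    simp [high, hne] at hh
  obtain ⟨j, hj, hjh⟩ := exists_mem_eq_inf (Q.preds i) hne
    fun j => (Q.trie I j).probeHigh B (pos j) b
  have h1 : (Q.trie I j).probeHigh B (pos j) b = (h : WithTop ℤ) := by rw [← hjh]; exact hh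
  have h2 : (Q.trie I j).probeEnd B (pos j) b < (Q.trie I j).len := by
    by_contra h2
    simp [TrieArray.probeHigh, h2] at h1
  have h3 : (Q.trie I j).key ((Q.trie I j).probeEnd B (pos j) b) = h + 1 := by
    rw [TrieArray.probeHigh, if_pos h2, WithTop.coe_inj] at h1
    omega
  have h4 : low < ((h + 1 : ℤ) : WithBot ℤ) := by
    by_contra h4
    exact hs ⟨j, hj, h2, by rw [h3]; exact not_lt.mp h4⟩
  have h5 : h + 1 ∈ Q.allKeys I := by
    simp only [allKeys, mem_biUnion, mem_univ, true_and, List.mem_toFinset]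
    refine ⟨j, ?_⟩
    rw [← h3, TrieArray.key, List.getD_eq_getElem _ _ h2]
    exact List.getElem_mem _
  refine card_lt_card ?_
  rw [ssubset_iff_of_subset]
  · exact ⟨h + 1, mem_filter.mpr ⟨h5, h4⟩, fun h6 => lt_irrefl _ (mem_filter.mp h6).2⟩
  · intro v hv
    simp only [mem_filter] at hv ⊢
    exact ⟨hv.1, h4.trans hv.2⟩

open Classical in
/-- The repeat-until loop in dimension `i`, with `mem` blocks of memory for the slices of this
dimension, where `inner low high leftoverMem` runs the more inner dimensions.
In each round, the memory is divided evenly among the atoms of the dimension, the atoms are probed,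
the slices up to the common upper bound are provisioned, the inner dimensions are run, and the next
round starts at the successor of the upper bound, unless the upper bound is `∞`.  `pos j` is the
position where the current slice of atom `j` starts, that is, where its preceding one ended.

The result is `none` if a probe of the run reports `SPILL`; otherwise the run has no spilled atoms,
and the result records what it does. -/
noncomputable def loop (Q : JoinQuery) (I : Q.Input) (B i mem : ℕ)
    (inner : WithBot ℤ → WithTop ℤ → ℕ → Option RunCost) (low : WithBot ℤ) (pos : Fin Q.m → ℕ) :
    Option RunCost :=
  let b := mem / #(Q.preds i)
  if hs : ∃ j ∈ Q.preds i, (Q.trie I j).Spill B (pos j) b low then none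
  else
    let q := fun j => (Q.trie I j).probeEnd B (pos j) b
    let e := fun j => (Q.trie I j).provisionEnd (pos j) (q j) (Q.high I B i b pos)
    let usedMem := ∑ j ∈ Q.preds i, (Q.trie I j).sliceBlocks B (pos j) (e j)
    let reads := ∑ j ∈ Q.preds i, (#((Q.trie I j).probeReads B (pos j) b) +
      #((Q.trie I j).provisionReads B (pos j) (q j) (Q.high I B i b pos)))
    match inner low (Q.high I B i b pos) (mem - usedMem) with
    | none => none
    | some c =>
      match hh : Q.high I B i b pos with
      | ⊤ => some ⟨reads + c.reads, c.tuples⟩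
      | (h : ℤ) =>
        match loop Q I B i mem inner ((h + 1 : ℤ) : WithBot ℤ) e with
        | none => none
        | some d => some ⟨reads + c.reads + d.reads, c.tuples + d.tuples⟩
termination_by #{v ∈ Q.allKeys I | low < ((v : ℤ) : WithBot ℤ)}
decreasing_by exact loop_decreasing Q I B i _ pos low hs h hh

/-- The recursive boxing procedure for the last `d` dimensions, with `memMax` blocks of memory in
total, which are evenly divided among the dimensions.  The bounds of the box in the other dimensions
are given by `low` and `high`.  When there are no more dimensions, the join is run in main memory on
the slices for the box. -/
noncomputable def boxUp (Q : JoinQuery) (I : Q.Input) (B memMax : ℕ) :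
    ℕ → ℕ → (ℕ → WithBot ℤ) → (ℕ → WithTop ℤ) → Option RunCost
  | 0, _, low, high => some ⟨0, (Q.boxOutput I low high).ncard⟩
  | d + 1, leftoverMem, low, high =>
    let i := Q.n - (d + 1)
    Q.loop I B i (memMax / Q.n + leftoverMem)
      (fun l h left => boxUp Q I B memMax d left (Function.update low i l)
        (Function.update high i h))
      ⊥ (fun _ => 0)

/-- A run of boxed Leapfrog Triejoin; `none` if a spill occurs. -/
noncomputable def boxedRun (Q : JoinQuery) (I : Q.Input) (B memMax : ℕ) : Option RunCost :=
  Q.boxUp I B memMax Q.n 0 (fun _ => ⊥) (fun _ => ⊤)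

end JoinQuery

/-- The I/O cost of a run: the blocks read, and the blocks written when output tuples of `n` words
are appended to the output through a buffer of one block. -/
def RunCost.io (c : RunCost) (B n : ℕ) : ℕ := c.reads + (n * c.tuples + B - 1) / B

/-! ### Binary search -/

/-! The heart is a bound on the number of rounds of one loop. Let a dimension give each of its atoms
`b` blocks. A round that is not the last has a finite upper bound, set by an atom whose slice cannot
take its next key without exceeding `b * B` words (`TrieArray.lt_sliceWords_probeEnd_succ`). That
atom also moves forward: otherwise the next round would probe from the same position, with a lower
bound equal to the key that does not fit, and would spill (`JoinQuery.exists_lt_nextPos`). A slice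
has at most a constant times as many words as leaves, because every trie node has a descendant on
the last level (`sliceWords_le`). So each such round raises a potential, bounded by a constant times
`|I|`, by more than `b * B`, and there are `N` of them with `N * b * B = O(|I|)`
(`JoinQuery.exists_rounds`).

If `b = 0`, no probe can advance and `N = 0`; otherwise `b` is a constant fraction of the memory
(`JoinQuery.memMax_le_budget`). With `|I| ≥ δ M` this gives `N + 1 = O(|I| / M)` in both cases. A
round itself reads `O(b + 1)` blocks, so a loop whose inner dimensions read at most `X` blocks per
round reads `O(|I| / B) + O(|I| / M) * X` blocks (`JoinQuery.reads_loop_le`). Dimensions beyond the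
rank have no atoms and read nothing; unrolling the recurrence over the `ℓ` dimensions up to the rank
gives `O((|I| / B) * (|I| / M) ^ (ℓ - 1))`.

For the writes, successive rounds treat disjoint ranges of values, so no output tuple is produced
twice (`JoinQuery.tuples_boxedRun_le`). The last partial output block is absorbed by the read bound,
since `|I| ≥ δ M ≥ δ B`. -/

theorem bisect_of_lt {P : ℕ → Bool} {lo hi : ℕ} (h : lo < hi) :
    bisect P lo hi =
      ((if P ((lo + hi + 1) / 2) then bisect P ((lo + hi + 1) / 2) hi
        else bisect P lo ((lo + hi + 1) / 2 - 1)).1,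
      (lo + hi + 1) / 2 :: (if P ((lo + hi + 1) / 2) then bisect P ((lo + hi + 1) / 2) hi
        else bisect P lo ((lo + hi + 1) / 2 - 1)).2) := by
  rw [bisect]
  simp [h]

theorem bisect_of_le {P : ℕ → Bool} {lo hi : ℕ} (h : hi ≤ lo) : bisect P lo hi = (lo, []) := by
  rw [bisect]
  simp [h]

/-- The result of a binary search lies in the range of the search, the test succeeds there unless
it is the lower end, the test fails at the next position unless it is the upper end, and only
positions of the range are tested. -/
theorem bisect_spec (P : ℕ → Bool) (lo hi : ℕ) (h : lo ≤ hi) :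
    lo ≤ (bisect P lo hi).1 ∧ (bisect P lo hi).1 ≤ hi ∧
      ((bisect P lo hi).1 = lo ∨ P (bisect P lo hi).1 = true) ∧
      ((bisect P lo hi).1 = hi ∨ P ((bisect P lo hi).1 + 1) = false) ∧
      ∀ p ∈ (bisect P lo hi).2, lo < p ∧ p ≤ hi := by
  induction hn : hi - lo using Nat.strong_induction_on generalizing lo hi with
  | _ n ih =>
    rcases h.lt_or_eq with hlt | rfl
    · rw [bisect_of_lt hlt]
      set mid := (lo + hi + 1) / 2 with hmid
      have h1 : lo < mid := by omega
      have h2 : mid ≤ hi := by omega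
      -- Whichever half is kept, its new end carries a tested witness: success at the lower end, or
      -- failure just past the upper end. So `P` need not be monotone.
      by_cases hP : P mid = true
      · obtain ⟨a1, a2, a3, a4, a5⟩ := ih (hi - mid) (by omega) mid hi h2 rfl
        simp only [hP, if_true]
        refine ⟨by omega, a2, Or.inr ?_, a4, ?_⟩
        · rcases a3 with a3 | a3
          · rw [a3, hP]
          · exact a3
        · intro p hp
          rcases List.mem_cons.mp hp with rfl | hp
          · exact ⟨h1, h2⟩
          · have := a5 p hp
            omega
      · obtain ⟨a1, a2, a3, a4, a5⟩ := ih (mid - 1 - lo) (by omega) lo (mid - 1) (by omega) rfl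
        simp only [hP]
        refine ⟨a1, by simpa using by omega, a3, Or.inr ?_, ?_⟩
        · rcases a4 with a4 | a4
          · simpa [a4, Nat.sub_add_cancel (Nat.one_le_of_lt h1)] using hP
          · exact a4
        · intro p hp
          rcases List.mem_cons.mp hp with rfl | hp
          · exact ⟨h1, h2⟩
          · have := a5 p hp
            omega
    · simp [bisect_of_le le_rfl]

theorem bisect_eq_right {P : ℕ → Bool} {lo hi : ℕ} (h : lo ≤ hi)
    (hP : ∀ p, lo < p → p ≤ hi → P p = true) : (bisect P lo hi).1 = hi := by
  obtain ⟨a1, a2, -, a4, -⟩ := bisect_spec P lo hi h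
  rcases a4 with a4 | a4
  · exact a4
  · by_contra hne
    rw [hP _ (by omega) (by omega)] at a4
    exact absurd a4 (by simp)

namespace TrieArray

/-! ### Well-formed TrieArrays -/

/-- The values of the first level increase strictly, and every node that is not a leaf has a
child. -/
structure IsWellFormed (T : TrieArray) : Prop where
  arity_pos : 0 < T.arity
  key_lt_key : ∀ ⦃p q⦄, p < q → q < T.len → T.key p < T.key q
  cut_add_cut_le : ∀ k ⦃s e⦄, s ≤ e → e ≤ T.len →
    T.cut e k + T.cut s (k + 1) ≤ T.cut e (k + 1) + T.cut s k

end TrieArray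

/-! ### The TrieArray of a relation is well-formed -/

theorem length_trieLevel {a : ℕ} (R : Finset (Fin a → ℤ)) (k : ℕ) :
    (trieLevel R k).length = #(trieNodes R k) := by
  simp [trieLevel]

theorem card_trieNodes_le {a : ℕ} (R : Finset (Fin a → ℤ)) (k : ℕ) : #(trieNodes R k) ≤ #R :=
  card_image_le

/-- No bound on `k` is needed: below the last level `take` no longer shortens a path, and a leaf
counts as its own only child. -/
theorem trieChildren_pos {a : ℕ} {R : Finset (Fin a → ℤ)} {k : ℕ} {u : List ℤ}
    (hu : u ∈ trieNodes R k) : 0 < trieChildren R k u := by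
  obtain ⟨t, ht, rfl⟩ := mem_image.mp hu
  refine card_pos.mpr ⟨(List.ofFn t).take (k + 1 + 1), mem_filter.mpr ⟨?_, ?_⟩⟩
  · exact mem_image_of_mem _ ht
  · simp [List.take_take]

theorem sum_trieChildren {a : ℕ} (R : Finset (Fin a → ℤ)) (k : ℕ) :
    ((trieLevel R k).map (trieChildren R k)).sum = #(trieNodes R (k + 1)) := by
  have h1 : ((trieLevel R k).map (trieChildren R k)).sum =
      ∑ u ∈ trieNodes R k, trieChildren R k u := by
    have h2 : (trieNodes R k).val = (trieLevel R k : Multiset (List ℤ)) := by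
      simp [trieLevel]
    rw [Finset.sum, h2, Multiset.map_coe, Multiset.sum_coe]
  rw [h1]
  refine (card_eq_sum_card_fiberwise ?_).symm
  intro w hw
  obtain ⟨t, ht, rfl⟩ := mem_image.mp hw
  refine mem_image.mpr ⟨t, ht, ?_⟩
  simp [List.take_take]

theorem sub_le_sum_take_sub {l : List ℕ} (hl : ∀ x ∈ l, 0 < x) {s e : ℕ} (hse : s ≤ e)
    (he : e ≤ l.length) : e + (l.take s).sum ≤ (l.take e).sum + s := by
  induction e, hse using Nat.le_induction with
  | base => omega
  | succ e hse ih =>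
    have h1 : e < l.length := he
    rw [List.sum_take_succ l e h1]
    have := hl _ (List.getElem_mem h1)
    have := ih (by omega)
    omega

namespace TrieArray

section ofRel

variable {a : ℕ} (R : Finset (Fin a → ℤ))

theorem len_ofRel : (ofRel R).len = #(trieNodes R 0) := by
  simp [len, ofRel, length_trieLevel]

theorem getD_idx_ofRel (k : ℕ) {p : ℕ} (hp : p ≤ #(trieNodes R k)) :
    ((ofRel R).idx k).getD p 0 = (((trieLevel R k).map (trieChildren R k)).take p).sum := by
  rw [List.getD_eq_getElem _ _ (by simpa [ofRel, length_trieLevel] using Nat.lt_succ_of_le hp)]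
  simp [ofRel, List.map_take]

theorem getD_idx_ofRel_le (k : ℕ) {p : ℕ} (hp : p ≤ #(trieNodes R k)) :
    ((ofRel R).idx k).getD p 0 ≤ #(trieNodes R (k + 1)) := by
  rw [getD_idx_ofRel R k hp, ← sum_trieChildren]
  conv_rhs => rw [← List.take_append_drop p ((trieLevel R k).map (trieChildren R k))]
  rw [List.sum_append]
  exact Nat.le_add_right _ _

theorem cut_ofRel_le (k : ℕ) {p : ℕ} (hp : p ≤ (ofRel R).len) :
    (ofRel R).cut p k ≤ #(trieNodes R k) := by
  induction k with
  | zero => rwa [len_ofRel] at hp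
  | succ k ih => exact getD_idx_ofRel_le R k ih

theorem cut_ofRel_mono_and_add_le (k : ℕ) {s e : ℕ} (hse : s ≤ e) (he : e ≤ (ofRel R).len) :
    (ofRel R).cut s k ≤ (ofRel R).cut e k ∧
    (ofRel R).cut e k + (ofRel R).cut s (k + 1) ≤ (ofRel R).cut e (k + 1) + (ofRel R).cut s k := by
  have step : ∀ k, (ofRel R).cut s k ≤ (ofRel R).cut e k →
      (ofRel R).cut e k + (ofRel R).cut s (k + 1) ≤
        (ofRel R).cut e (k + 1) + (ofRel R).cut s k := by
    intro k hk
    have he' := cut_ofRel_le R k he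
    simp only [cut]
    rw [getD_idx_ofRel R k he', getD_idx_ofRel R k (hk.trans he')]
    refine sub_le_sum_take_sub ?_ hk (by simpa [length_trieLevel] using he')
    intro x hx
    obtain ⟨u, hu, rfl⟩ := List.mem_map.mp hx
    exact trieChildren_pos (by simpa [trieLevel] using hu)
  suffices h : (ofRel R).cut s k ≤ (ofRel R).cut e k from ⟨h, step k h⟩
  induction k with
  | zero => exact hse
  | succ k ih =>
    have := step k ih
    omega

theorem key_ofRel_lt_key (ha : 0 < a) {p q : ℕ} (hpq : p < q) (hq : q < (ofRel R).len) :
    (ofRel R).key p < (ofRel R).key q := by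
  have hq' : q < (trieLevel R 0).length := by rwa [length_trieLevel, ← len_ofRel]
  have hp' : p < (trieLevel R 0).length := hpq.trans hq'
  -- Paths of level `0` are singletons, so their lexicographic order is the order of the values.
  have hform : ∀ u ∈ trieLevel R 0, u = [u.getLastD 0] := by
    intro u hu
    obtain ⟨t, -, rfl⟩ := mem_image.mp (show u ∈ trieNodes R 0 by simpa [trieLevel] using hu)
    obtain ⟨b, rfl⟩ : ∃ b, a = b + 1 := ⟨a - 1, by omega⟩
    simp [List.ofFn_succ]
  have hlt : (trieLevel R 0)[p] < (trieLevel R 0)[q] :=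
    (sortedLT_sort (trieNodes R 0)).getElem_lt_getElem_iff.mpr hpq
  have key_eq : ∀ i (hi : i < (trieLevel R 0).length),
      (ofRel R).key i = ((trieLevel R 0)[i]).getLastD 0 := by
    intro i hi
    rw [key, List.getD_eq_getElem _ _ (by simpa [ofRel] using hi)]
    simp [ofRel]
  rw [key_eq p hp', key_eq q hq']
  rw [hform _ (List.getElem_mem hp'), hform _ (List.getElem_mem hq')] at hlt
  simpa [List.cons_lt_cons_iff] using hlt

theorem ofRel_isWellFormed (ha : 0 < a) : (ofRel R).IsWellFormed where
  arity_pos := ha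
  key_lt_key _ _ hpq hq := key_ofRel_lt_key R ha hpq hq
  cut_add_cut_le k _ _ hse he := (cut_ofRel_mono_and_add_le R k hse he).2

end ofRel

end TrieArray

namespace TrieArray

variable {T : TrieArray}

namespace IsWellFormed

theorem cut_le_cut (hT : T.IsWellFormed) (k : ℕ) {s e : ℕ} (hse : s ≤ e) (he : e ≤ T.len) :
    T.cut s k ≤ T.cut e k := by
  induction k with
  | zero => exact hse
  | succ k ih =>
    have := hT.cut_add_cut_le k hse he
    omega

theorem cut_sub_cut_le (hT : T.IsWellFormed) {k l : ℕ} (hkl : k ≤ l) {s e : ℕ} (hse : s ≤ e)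
    (he : e ≤ T.len) : T.cut e k - T.cut s k ≤ T.cut e l - T.cut s l := by
  induction l, hkl using Nat.le_induction with
  | base => exact le_rfl
  | succ l _ ih =>
    have := hT.cut_add_cut_le l hse he
    omega

/-- The size of a slice is linear in the number of its leaves. -/
theorem sliceWords_le (hT : T.IsWellFormed) {s e : ℕ} (hse : s ≤ e) (he : e ≤ T.len) :
    T.sliceWords s e ≤ 3 * T.arity * (T.cut e (T.arity - 1) - T.cut s (T.arity - 1)) := by
  rw [sliceWords]
  split_ifs with hlt
  · set D := T.cut e (T.arity - 1) - T.cut s (T.arity - 1) with hD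
    have hk : ∀ k, k < T.arity → T.cut e k - T.cut s k ≤ D := fun k hk =>
      hT.cut_sub_cut_le (by omega) hse he
    have hD1 : 1 ≤ D := by
      have := hk 0 hT.arity_pos
      simp only [cut] at this
      omega
    have h1 : ∑ k ∈ range T.arity, (T.cut e k - T.cut s k) ≤ T.arity * D := by
      simpa using sum_le_card_nsmul (range T.arity) _ D fun k hk' => hk k (mem_range.mp hk')
    have h2 : ∑ k ∈ range (T.arity - 1), (T.cut e k - T.cut s k + 1) ≤
        (T.arity - 1) * (D + D) := by
      simpa using sum_le_card_nsmul (range (T.arity - 1)) _ (D + D) fun k hk' => by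
        have := hk k (by have := mem_range.mp hk'; omega)
        omega
    have h3 : (T.arity - 1) * (D + D) ≤ T.arity * (D + D) :=
      Nat.mul_le_mul_right _ (Nat.sub_le _ _)
    calc _ ≤ T.arity * D + T.arity * (D + D) := by omega
      _ = 3 * T.arity * D := by ring
  · exact Nat.zero_le _

end IsWellFormed

theorem cut_sub_cut_le_sliceWords {s e k : ℕ} (hse : s < e) (hk : k < T.arity) :
    T.cut e k - T.cut s k ≤ T.sliceWords s e := by
  rw [sliceWords, if_pos hse]
  exact (single_le_sum (f := fun k => T.cut e k - T.cut s k) (fun _ _ => Nat.zero_le _)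
    (mem_range.mpr hk)).trans (Nat.le_add_right _ _)

theorem sliceBlocks_le_iff {B s e b : ℕ} (hB : 0 < B) :
    T.sliceBlocks B s e ≤ b ↔ T.sliceWords s e ≤ b * B := by
  rw [sliceBlocks, ← Nat.lt_succ_iff, Nat.div_lt_iff_lt_mul hB, Nat.succ_mul]
  omega

/-! ### A probe -/

section probe

variable {B s b : ℕ}

theorem le_probeEnd (hs : s ≤ T.len) : s ≤ T.probeEnd B s b :=
  (bisect_spec _ _ _ (le_min hs (Nat.le_add_right _ _))).1

theorem probeEnd_le_min (hs : s ≤ T.len) : T.probeEnd B s b ≤ min T.len (s + b * B) :=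
  (bisect_spec _ _ _ (le_min hs (Nat.le_add_right _ _))).2.1

theorem probeEnd_le_len (hs : s ≤ T.len) : T.probeEnd B s b ≤ T.len :=
  (probeEnd_le_min hs).trans (min_le_left _ _)

theorem sliceWords_probeEnd_le (hB : 0 < B) (hs : s ≤ T.len) :
    T.sliceWords s (T.probeEnd B s b) ≤ b * B := by
  rcases (bisect_spec (fun q => decide (T.sliceBlocks B s q ≤ b)) _ _
    (le_min hs (Nat.le_add_right s (b * B)))).2.2.1 with h | h
  · have h' : T.probeEnd B s b = s := h
    simp [h', sliceWords]
  · exact (sliceBlocks_le_iff hB).mp (of_decide_eq_true h)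

/-- The slice found by a probe cannot be extended. -/
theorem lt_sliceWords_probeEnd_succ (hT : T.IsWellFormed) (hB : 0 < B) (hs : s ≤ T.len)
    (hq : T.probeEnd B s b < T.len) : b * B < T.sliceWords s (T.probeEnd B s b + 1) := by
  rcases (bisect_spec (fun q => decide (T.sliceBlocks B s q ≤ b)) _ _
    (le_min hs (Nat.le_add_right s (b * B)))).2.2.2.1 with h | h
  -- The search was stopped by its range, not by the test. As the array goes on, the range ended at
  -- `s + b * B`, and one more position gives `b * B + 1` entries on level `0` alone.
  · have h' : T.probeEnd B s b = min T.len (s + b * B) := h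
    have h1 : T.probeEnd B s b = s + b * B := by omega
    have h2 : T.cut (T.probeEnd B s b + 1) 0 - T.cut s 0 ≤ _ :=
      cut_sub_cut_le_sliceWords (by omega) hT.arity_pos
    simp only [cut] at h2
    omega
  · exact not_le.mp fun hle => of_decide_eq_false h ((sliceBlocks_le_iff hB).mpr hle)

theorem cut_probeEnd_le (hB : 0 < B) (hs : s ≤ T.len) {k : ℕ}
    (hk : k < T.arity) : T.cut (T.probeEnd B s b) k ≤ T.cut s k + b * B := by
  rcases (le_probeEnd (B := B) (b := b) hs).eq_or_lt with h | h
  · rw [← h]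
    exact Nat.le_add_right _ _
  · have := cut_sub_cut_le_sliceWords h hk
    have := sliceWords_probeEnd_le (b := b) hB hs
    omega

/-- `b + 1` consecutive blocks contain every run of `b * B + 1` entries. -/
theorem div_mem_Icc {c x : ℕ} (hB : 0 < B) (h1 : c ≤ x) (h2 : x ≤ c + b * B) :
    x / B ∈ Icc (c / B) (c / B + b) := by
  rw [mem_Icc]
  refine ⟨Nat.div_le_div_right h1, (Nat.div_le_div_right h2).trans ?_⟩
  rw [Nat.add_mul_div_right _ _ hB]

/-- In each index array only entries within `b * B` of the start of the slice are read, which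
touches at most `b + 1` blocks however many positions are tested. The last summand is the lookup of
the bounding value. -/
theorem card_probeReads_le (hT : T.IsWellFormed) (hB : 0 < B) (hs : s ≤ T.len) :
    #(T.probeReads B s b) ≤ (T.arity - 1) * (b + 1) + 1 := by
  refine (card_union_le _ _).trans (add_le_add ?_ ?_)
  · have hsub : ((s :: (T.probeSearch B s b).2).toFinset.biUnion fun q =>
        {k ∈ range (T.arity - 1) | T.cut q k - T.cut s k ≤ b * B}.image fun k =>
          idxBlock B k (T.cut q k)) ⊆
        (range (T.arity - 1)).biUnion fun k =>
          (Icc (T.cut s k / B) (T.cut s k / B + b)).image fun x => ((true, k, x) : Block) := by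
      intro x hx
      simp only [mem_biUnion, mem_image, mem_filter, List.mem_toFinset] at hx
      obtain ⟨q, hq, k, ⟨hk, hle⟩, rfl⟩ := hx
      have hsq : s ≤ q ∧ q ≤ T.len := by
        rcases List.mem_cons.mp hq with rfl | hq
        · exact ⟨le_rfl, hs⟩
        · have := (bisect_spec (fun q => decide (T.sliceBlocks B s q ≤ b)) _ _
            (le_min hs (Nat.le_add_right s (b * B)))).2.2.2.2 q hq
          omega
      have := hT.cut_le_cut k hsq.1 hsq.2
      exact mem_biUnion.mpr ⟨k, hk, mem_image.mpr ⟨_, div_mem_Icc hB this (by omega), rfl⟩⟩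
    refine (card_le_card hsub).trans ((card_biUnion_le_card_mul _ _ (b + 1) ?_).trans_eq (by simp))
    intro k _
    exact card_image_le.trans (by simp; omega)
  · split_ifs <;> simp

end probe

/-! ### Provisioning -/

section provision

variable {B s b q : ℕ} {high : WithTop ℤ}

theorem le_provisionEnd (hsq : s ≤ q) : s ≤ T.provisionEnd s q high :=
  (bisect_spec _ _ _ hsq).1

theorem provisionEnd_le (hsq : s ≤ q) : T.provisionEnd s q high ≤ q :=
  (bisect_spec _ _ _ hsq).2.1

/-- The slice of an atom that determines the common upper bound is the one that was probed. -/
theorem provisionEnd_eq (hT : T.IsWellFormed) (hs : s ≤ T.len)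
    (hq : T.probeEnd B s b < T.len) :
    T.provisionEnd s (T.probeEnd B s b) (T.probeHigh B s b) = T.probeEnd B s b := by
  -- Every earlier key is an integer strictly below the key at the probed end, hence at most that
  -- key minus one, which is the reported bound.
  refine bisect_eq_right (le_probeEnd hs) fun p hp1 hp2 => decide_eq_true ?_
  rw [probeHigh, if_pos hq, WithTop.coe_le_coe]
  have := hT.key_lt_key (show p - 1 < T.probeEnd B s b by omega) hq
  omega

theorem card_provisionReads_le (hT : T.IsWellFormed) (hB : 0 < B) (hs : s ≤ T.len) :
    #(T.provisionReads B s (T.probeEnd B s b) high) ≤ (2 * T.arity) * (b + 1) := by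
  set q := T.probeEnd B s b with hqdef
  have hsq : s ≤ q := le_probeEnd hs
  have hql : q ≤ T.len := probeEnd_le_len hs
  have hse : s ≤ T.provisionEnd s q high := le_provisionEnd hsq
  have heq : T.provisionEnd s q high ≤ q := provisionEnd_le hsq
  have hcut : ∀ k, k < T.arity → T.cut (T.provisionEnd s q high) k ≤ T.cut s k + b * B :=
    fun k hk => (hT.cut_le_cut k heq hql).trans (cut_probeEnd_le hB hs hk)
  have hblocks : ∀ (c : Bool) (k x : ℕ),
      #((Icc x (x + b)).image fun y => ((c, k, y) : Block)) ≤ b + 1 := fun c k x =>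
    card_image_le.trans (by simp; omega)
  have h1 : #((T.provisionSearch s q high).2.toFinset.image fun p => valBlock B 0 (p - 1)) ≤
      b + 1 := by
    refine (card_le_card ?_).trans (hblocks false 0 (s / B))
    intro x hx
    simp only [mem_image, List.mem_toFinset] at hx
    obtain ⟨p, hp, rfl⟩ := hx
    have hp' := (bisect_spec _ _ _ hsq).2.2.2.2 p hp
    have hq' : q ≤ s + b * B := (probeEnd_le_min hs).trans (min_le_right _ _)
    exact mem_image.mpr ⟨_, div_mem_Icc hB (c := s) (by omega) (by omega), rfl⟩
  have h2 : #((range T.arity).biUnion fun k =>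
      (Ico (T.cut s k) (T.cut (T.provisionEnd s q high) k)).image (valBlock B k)) ≤
      T.arity * (b + 1) := by
    refine (card_biUnion_le_card_mul _ _ (b + 1) fun k hk => ?_).trans_eq (by simp)
    refine (card_le_card ?_).trans (hblocks false k (T.cut s k / B))
    intro x hx
    obtain ⟨p, hp, rfl⟩ := mem_image.mp hx
    have hp' := mem_Ico.mp hp
    have := hcut k (mem_range.mp hk)
    exact mem_image.mpr ⟨_, div_mem_Icc hB (c := T.cut s k) (by omega) (by omega), rfl⟩
  have h3 : #((range (T.arity - 1)).biUnion fun k =>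
      (Icc (T.cut s k) (T.cut (T.provisionEnd s q high) k)).image (idxBlock B k)) ≤
      (T.arity - 1) * (b + 1) := by
    refine (card_biUnion_le_card_mul _ _ (b + 1) fun k hk => ?_).trans_eq (by simp)
    refine (card_le_card ?_).trans (hblocks true k (T.cut s k / B))
    intro x hx
    obtain ⟨p, hp, rfl⟩ := mem_image.mp hx
    have hp' := mem_Icc.mp hp
    have := hcut k (by have := mem_range.mp hk; omega)
    exact mem_image.mpr ⟨_, div_mem_Icc hB (c := T.cut s k) (by omega) (by omega), rfl⟩
  calc _ ≤ (b + 1 + T.arity * (b + 1)) + (T.arity - 1) * (b + 1) :=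
        (card_union_le _ _).trans (add_le_add ((card_union_le _ _).trans (add_le_add h1 h2)) h3)
    _ = (1 + T.arity + (T.arity - 1)) * (b + 1) := by ring
    _ = (2 * T.arity) * (b + 1) := by
      have := hT.arity_pos
      congr 1
      omega

/-- The number of blocks that one round reads for one atom. -/
theorem card_probeReads_add_card_provisionReads_le (hT : T.IsWellFormed) (hB : 0 < B)
    (hs : s ≤ T.len) :
    #(T.probeReads B s b) + #(T.provisionReads B s (T.probeEnd B s b) high) ≤
      3 * T.arity * (b + 1) := by
  have h1 := card_probeReads_le (b := b) hT hB hs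
  have h2 := card_provisionReads_le (b := b) (high := high) hT hB hs
  obtain ⟨a, ha⟩ : ∃ a, T.arity = a + 1 := ⟨T.arity - 1, by have := hT.arity_pos; omega⟩
  rw [ha] at h1 h2 ⊢
  rw [Nat.add_sub_cancel] at h1
  nlinarith

end provision

/-! ### The potential of an atom -/

/-- A measure for how much of the array precedes the position `p`.  The entry at `p` is counted in
half, since it is both the entry that does not fit a slice and the first entry of the next slice. -/
def potential (T : TrieArray) (p : ℕ) : ℕ :=
  3 * T.arity * (T.cut p (T.arity - 1) + T.cut (min (p + 1) T.len) (T.arity - 1))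

theorem potential_mono (hT : T.IsWellFormed) {p q : ℕ} (hpq : p ≤ q) (hq : q ≤ T.len) :
    T.potential p ≤ T.potential q := by
  refine Nat.mul_le_mul_left _ (add_le_add (hT.cut_le_cut _ hpq hq) (hT.cut_le_cut _ ?_ ?_))
  · omega
  · omega

/-- A slice that cannot be extended uses up as much potential as the budget has words. -/
theorem potential_add_lt (hT : T.IsWellFormed) {B s b : ℕ} (hB : 0 < B) (hs : s ≤ T.len)
    (hsq : s < T.probeEnd B s b) (hq : T.probeEnd B s b < T.len) :
    T.potential s + b * B < T.potential (T.probeEnd B s b) := by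
  have h1 := lt_sliceWords_probeEnd_succ hT hB hs hq
  set q := T.probeEnd B s b
  have h2 := hT.sliceWords_le (show s ≤ q + 1 by omega) (show q + 1 ≤ T.len by omega)
  -- Progress enters here: `s + 1 ≤ q` ensures that the leaves below the entry at `s`, counted again
  -- in the overflowing slice, have been paid for.
  have h3 := hT.cut_le_cut (T.arity - 1) (show s + 1 ≤ q by omega) hq.le
  have h4 := hT.cut_le_cut (T.arity - 1) (show s ≤ q + 1 by omega) (show q + 1 ≤ T.len by omega)
  rw [potential, potential, min_eq_left (show s + 1 ≤ T.len by omega),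
    min_eq_left (show q + 1 ≤ T.len by omega)]
  calc _ < 3 * T.arity * (T.cut s (T.arity - 1) + T.cut (s + 1) (T.arity - 1)) +
        3 * T.arity * (T.cut (q + 1) (T.arity - 1) - T.cut s (T.arity - 1)) := by omega
    _ = 3 * T.arity * ((T.cut s (T.arity - 1) + T.cut (s + 1) (T.arity - 1)) +
        (T.cut (q + 1) (T.arity - 1) - T.cut s (T.arity - 1))) := by ring
    _ ≤ _ := Nat.mul_le_mul_left _ (by omega)

theorem potential_ofRel_le {a : ℕ} (R : Finset (Fin a → ℤ)) {p : ℕ} (hp : p ≤ (ofRel R).len) :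
    (ofRel R).potential p ≤ 6 * a * #R := by
  have h1 := (cut_ofRel_le R (a - 1) hp).trans (card_trieNodes_le R _)
  have h2 := (cut_ofRel_le R (a - 1) (min_le_right (p + 1) _)).trans (card_trieNodes_le R _)
  calc (ofRel R).potential p ≤ 3 * a * (#R + #R) := Nat.mul_le_mul_left _ (add_le_add h1 h2)
    _ = 6 * a * #R := by ring

end TrieArray

namespace JoinQuery

variable {Q : JoinQuery} {I : Q.Input}

theorem trie_isWellFormed (Q : JoinQuery) (I : Q.Input) (j : Fin Q.m) :
    (Q.trie I j).IsWellFormed :=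
  TrieArray.ofRel_isWellFormed _ (Q.arity_pos _)

/-! ### One round of the loop -/

/-- The positions at which the slices of a round end. -/
noncomputable def nextPos (Q : JoinQuery) (I : Q.Input) (B i b : ℕ) (pos : Fin Q.m → ℕ) :
    Fin Q.m → ℕ := fun j =>
  (Q.trie I j).provisionEnd (pos j) ((Q.trie I j).probeEnd B (pos j) b) (Q.high I B i b pos)

/-- The number of blocks read in a round. -/
noncomputable def roundReads (Q : JoinQuery) (I : Q.Input) (B i b : ℕ) (pos : Fin Q.m → ℕ) : ℕ :=
  ∑ j ∈ Q.preds i, (#((Q.trie I j).probeReads B (pos j) b) +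
    #((Q.trie I j).provisionReads B (pos j) ((Q.trie I j).probeEnd B (pos j) b)
      (Q.high I B i b pos)))

/-- An induction principle for runs of the loop without spills. -/
theorem loop_induction {B i mem : ℕ} {inner : WithBot ℤ → WithTop ℤ → ℕ → Option RunCost}
    {motive : WithBot ℤ → (Fin Q.m → ℕ) → RunCost → Prop}
    (last : ∀ low pos left c, left ≤ mem →
      Q.high I B i (mem / #(Q.preds i)) pos = ⊤ → inner low ⊤ left = some c →
      motive low pos ⟨Q.roundReads I B i (mem / #(Q.preds i)) pos + c.reads, c.tuples⟩)
    (step : ∀ low pos left c d (h : ℤ), left ≤ mem →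
      (¬ ∃ j ∈ Q.preds i, (Q.trie I j).Spill B (pos j) (mem / #(Q.preds i)) low) →
      Q.high I B i (mem / #(Q.preds i)) pos = (h : WithTop ℤ) → inner low h left = some c →
      (¬ ∃ j ∈ Q.preds i, (Q.trie I j).Spill B (Q.nextPos I B i (mem / #(Q.preds i)) pos j)
        (mem / #(Q.preds i)) ((h + 1 : ℤ) : WithBot ℤ)) →
      motive ((h + 1 : ℤ) : WithBot ℤ) (Q.nextPos I B i (mem / #(Q.preds i)) pos) d →
      motive low pos ⟨Q.roundReads I B i (mem / #(Q.preds i)) pos + c.reads + d.reads,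
        c.tuples + d.tuples⟩)
    {low : WithBot ℤ} {pos : Fin Q.m → ℕ} {c : RunCost}
    (hc : Q.loop I B i mem inner low pos = some c) : motive low pos c := by
  -- The absence of a spill in the first round is carried along with the motive, so that the step
  -- case may use it for the next round.
  have key : ∀ N : ℕ, ∀ low pos c, #{v ∈ Q.allKeys I | low < ((v : ℤ) : WithBot ℤ)} = N →
      Q.loop I B i mem inner low pos = some c →
      (¬ ∃ j ∈ Q.preds i, (Q.trie I j).Spill B (pos j) (mem / #(Q.preds i)) low) ∧
        motive low pos c := by
    intro N
    induction N using Nat.strong_induction_on with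
    | _ N ih =>
      intro low pos c hN hc
      rw [loop] at hc
      dsimp only at hc
      split_ifs at hc with hs
      refine ⟨hs, ?_⟩
      split at hc
      · exact absurd hc (by simp)
      · rename_i c1 hc1
        split at hc
        · rename_i hh
          rw [hh] at hc1
          obtain rfl := Option.some.inj hc
          exact last low pos _ c1 (Nat.sub_le _ _) hh hc1
        · rename_i h hh
          split at hc
          · exact absurd hc (by simp)
          · rename_i d hd
            obtain rfl := Option.some.inj hc
            have hlt := loop_decreasing Q I B i _ pos low hs h hh
            obtain ⟨hs', hm⟩ := ih _ (hN ▸ hlt) _ _ _ rfl hd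
            rw [hh] at hc1
            exact step low pos _ c1 d h (Nat.sub_le _ _) hs hh hc1 hs' hm
  exact (key _ low pos c rfl hc).2

/-- If the upper bound of a round is finite, then some atom determines it. -/
theorem exists_key_probeEnd_eq {B i b : ℕ} {pos : Fin Q.m → ℕ} {h : ℤ}
    (hh : Q.high I B i b pos = (h : WithTop ℤ)) :
    ∃ j ∈ Q.preds i, (Q.trie I j).probeHigh B (pos j) b = (h : WithTop ℤ) ∧
      (Q.trie I j).probeEnd B (pos j) b < (Q.trie I j).len ∧
      (Q.trie I j).key ((Q.trie I j).probeEnd B (pos j) b) = h + 1 := by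
  have hne : (Q.preds i).Nonempty := by
    by_contra hne
    rw [not_nonempty_iff_eq_empty] at hne
    simp [high, hne] at hh
  obtain ⟨j, hj, hjh⟩ := exists_mem_eq_inf (Q.preds i) hne
    fun j => (Q.trie I j).probeHigh B (pos j) b
  have h1 : (Q.trie I j).probeHigh B (pos j) b = (h : WithTop ℤ) := by rw [← hjh]; exact hh
  have h2 : (Q.trie I j).probeEnd B (pos j) b < (Q.trie I j).len := by
    by_contra h2
    simp [TrieArray.probeHigh, h2] at h1
  refine ⟨j, hj, h1, h2, ?_⟩
  rw [TrieArray.probeHigh, if_pos h2, WithTop.coe_inj] at h1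
  omega

/-- The atom that sets the bound has `h + 1` as its first key outside the slice; were this key at
most `low`, its probe would spill. -/
theorem low_lt_of_not_spill {B i b : ℕ} {pos : Fin Q.m → ℕ} {low : WithBot ℤ} {h : ℤ}
    (hs : ¬ ∃ j ∈ Q.preds i, (Q.trie I j).Spill B (pos j) b low)
    (hh : Q.high I B i b pos = (h : WithTop ℤ)) : low < ((h + 1 : ℤ) : WithBot ℤ) := by
  obtain ⟨j, hj, -, h2, h3⟩ := exists_key_probeEnd_eq hh
  by_contra h4
  exact hs ⟨j, hj, h2, by rw [h3]; exact not_lt.mp h4⟩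

theorem roundReads_le {B i b : ℕ} {pos : Fin Q.m → ℕ} (hB : 0 < B)
    (hpos : ∀ j, pos j ≤ (Q.trie I j).len) :
    Q.roundReads I B i b pos ≤ (∑ j ∈ Q.preds i, 3 * Q.arity (Q.rel j)) * (b + 1) := by
  rw [sum_mul]
  exact sum_le_sum fun j _ =>
    TrieArray.card_probeReads_add_card_provisionReads_le (Q.trie_isWellFormed I j) hB (hpos j)

theorem le_nextPos {B i b : ℕ} {pos : Fin Q.m → ℕ} (hpos : ∀ j, pos j ≤ (Q.trie I j).len)
    (j : Fin Q.m) : pos j ≤ Q.nextPos I B i b pos j :=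
  TrieArray.le_provisionEnd (TrieArray.le_probeEnd (hpos j))

theorem nextPos_le_len {B i b : ℕ} {pos : Fin Q.m → ℕ} (hpos : ∀ j, pos j ≤ (Q.trie I j).len)
    (j : Fin Q.m) : Q.nextPos I B i b pos j ≤ (Q.trie I j).len :=
  (TrieArray.provisionEnd_le (TrieArray.le_probeEnd (hpos j))).trans
    (TrieArray.probeEnd_le_len (hpos j))

/-- If neither a round that has a finite upper bound nor the next round spills, then an atom
makes progress with a slice that cannot be extended. -/
theorem exists_lt_nextPos {B i b : ℕ} {pos : Fin Q.m → ℕ} {h : ℤ}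
    (hpos : ∀ j, pos j ≤ (Q.trie I j).len)
    (hh : Q.high I B i b pos = (h : WithTop ℤ))
    (hs : ¬ ∃ j ∈ Q.preds i, (Q.trie I j).Spill B (Q.nextPos I B i b pos j) b
      ((h + 1 : ℤ) : WithBot ℤ)) :
    ∃ j ∈ Q.preds i, Q.nextPos I B i b pos j = (Q.trie I j).probeEnd B (pos j) b ∧
      pos j < (Q.trie I j).probeEnd B (pos j) b ∧
      (Q.trie I j).probeEnd B (pos j) b < (Q.trie I j).len := by
  obtain ⟨j, hj, h1, h2, h3⟩ := exists_key_probeEnd_eq hh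
  have hnext : Q.nextPos I B i b pos j = (Q.trie I j).probeEnd B (pos j) b := by
    rw [nextPos, hh, ← h1]
    exact TrieArray.provisionEnd_eq (Q.trie_isWellFormed I j) (hpos j) h2
  refine ⟨j, hj, hnext, lt_of_le_of_ne (TrieArray.le_probeEnd (hpos j)) fun heq => ?_, h2⟩
  -- Without progress, the next probe has the same start and budget and ends at the same key `h +
  -- 1`, now equal to the lower bound: a spill.
  refine hs ⟨j, hj, ?_⟩
  rw [hnext, ← heq, TrieArray.Spill]
  exact ⟨h2, by rw [h3]⟩

/-- The potential of the atoms of dimension `i`. -/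
def potential (Q : JoinQuery) (I : Q.Input) (i : ℕ) (pos : Fin Q.m → ℕ) : ℕ :=
  ∑ j ∈ Q.preds i, (Q.trie I j).potential (pos j)

/-- The sum of the arities of the atoms. -/
def totalArity (Q : JoinQuery) : ℕ := ∑ j, Q.arity (Q.rel j)

theorem card_le_inputSize (Q : JoinQuery) (I : Q.Input) (r : Fin Q.numRel) :
    #(I r) ≤ Q.inputSize I :=
  single_le_sum (f := fun r => #(I r)) (fun _ _ => Nat.zero_le _) (mem_univ r)

/-- Several atoms may share a relation, so each atom is charged the full input size. -/
theorem potential_le {i : ℕ} {pos : Fin Q.m → ℕ} (hpos : ∀ j, pos j ≤ (Q.trie I j).len) :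
    Q.potential I i pos ≤ 6 * Q.totalArity * Q.inputSize I := by
  calc Q.potential I i pos ≤ ∑ j, (Q.trie I j).potential (pos j) :=
        sum_le_sum_of_subset (subset_univ _)
    _ ≤ ∑ j, 6 * Q.arity (Q.rel j) * Q.inputSize I :=
        sum_le_sum fun j _ => (TrieArray.potential_ofRel_le _ (hpos j)).trans
          (Nat.mul_le_mul_left _ (Q.card_le_inputSize I _))
    _ = 6 * Q.totalArity * Q.inputSize I := by rw [totalArity, mul_sum, sum_mul]

theorem potential_add_lt_potential_nextPos {B i b : ℕ} {pos : Fin Q.m → ℕ} {h : ℤ} (hB : 0 < B)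
    (hpos : ∀ j, pos j ≤ (Q.trie I j).len)
    (hh : Q.high I B i b pos = (h : WithTop ℤ))
    (hs : ¬ ∃ j ∈ Q.preds i, (Q.trie I j).Spill B (Q.nextPos I B i b pos j) b
      ((h + 1 : ℤ) : WithBot ℤ)) :
    Q.potential I i pos + b * B < Q.potential I i (Q.nextPos I B i b pos) := by
  obtain ⟨j, hj, h1, h2, h3⟩ := exists_lt_nextPos hpos hh hs
  have h4 := TrieArray.potential_add_lt (Q.trie_isWellFormed I j) hB (hpos j) h2 h3
  rw [← h1] at h4
  rw [potential, potential, ← add_sum_erase _ _ hj, ← add_sum_erase _ _ hj]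
  have h5 : ∑ k ∈ (Q.preds i).erase j, (Q.trie I k).potential (pos k) ≤
      ∑ k ∈ (Q.preds i).erase j, (Q.trie I k).potential (Q.nextPos I B i b pos k) :=
    sum_le_sum fun k _ => TrieArray.potential_mono (Q.trie_isWellFormed I k) (le_nextPos hpos k)
      (nextPos_le_len hpos k)
  omega

/-! ### The number of rounds of the loop -/

/-- A loop without spills has `N + 1` rounds, where the slices of `N` rounds fill their budget. -/
theorem exists_rounds {B i mem X : ℕ} {inner : WithBot ℤ → WithTop ℤ → ℕ → Option RunCost}
    (hB : 0 < B)
    (hX : ∀ l h left c, left ≤ mem → inner l h left = some c → c.reads ≤ X)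
    {low : WithBot ℤ} {c : RunCost} (hc : Q.loop I B i mem inner low (fun _ => 0) = some c) :
    ∃ N : ℕ, c.reads ≤ (N + 1) *
        ((∑ j ∈ Q.preds i, 3 * Q.arity (Q.rel j)) * (mem / #(Q.preds i) + 1) + X) ∧
      N * (mem / #(Q.preds i) * B) ≤ 6 * Q.totalArity * Q.inputSize I ∧
      (mem / #(Q.preds i) = 0 → N = 0) := by
  set b := mem / #(Q.preds i) with hb
  set r := (∑ j ∈ Q.preds i, 3 * Q.arity (Q.rel j)) * (b + 1) with hr
  -- Going backwards from the last round, the potential already reached is added to the claim, so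
  -- that the gains of the remaining rounds add up below the maximum.
  have key : (∀ j, (fun _ => 0 : Fin Q.m → ℕ) j ≤ (Q.trie I j).len) →
      ∃ N : ℕ, c.reads ≤ (N + 1) * (r + X) ∧
      N * (b * B) + Q.potential I i (fun _ => 0) ≤ 6 * Q.totalArity * Q.inputSize I ∧
      (b = 0 → N = 0) := by
    refine loop_induction (motive := fun _ pos c => (∀ j, pos j ≤ (Q.trie I j).len) →
      ∃ N : ℕ, c.reads ≤ (N + 1) * (r + X) ∧
      N * (b * B) + Q.potential I i pos ≤ 6 * Q.totalArity * Q.inputSize I ∧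
      (b = 0 → N = 0)) ?_ ?_ hc
    · intro low pos left c hleft _ hc hpos
      refine ⟨0, ?_, by simpa using potential_le hpos, fun _ => rfl⟩
      have := roundReads_le (i := i) (b := b) hB hpos
      have := hX _ _ _ _ hleft hc
      simp only [zero_add, one_mul, ← hb]
      omega
    · intro low pos left c d h hleft _ hh hc hs' ih hpos
      obtain ⟨N, h1, h2, -⟩ := ih (nextPos_le_len hpos)
      simp only [← hb] at hh hs' h1 h2 ⊢
      refine ⟨N + 1, ?_, ?_, fun h0 => ?_⟩
      · have := roundReads_le (i := i) (b := b) hB hpos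
        have := hX _ _ _ _ hleft hc
        rw [add_mul (N + 1), one_mul]
        omega
      · have := potential_add_lt_potential_nextPos hB hpos hh hs'
        rw [add_mul, one_mul]
        omega
      -- With `b = 0` the range of the probe is a single position, which contradicts progress.
      · obtain ⟨j, -, -, h3, -⟩ := exists_lt_nextPos hpos hh hs'
        have h4 := TrieArray.probeEnd_le_min (B := B) (b := b) (hpos j)
        rw [h0] at h3 h4
        omega
  obtain ⟨N, h1, h2, h3⟩ := key fun j => Nat.zero_le _
  exact ⟨N, h1, by omega, h3⟩

/-! ### The number of output tuples -/

/-- Every variable occurs in an atom, so every coordinate ranges over a finite set. Comparing values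
of `ncard` needs this, as infinite sets have `ncard` zero. -/
theorem output_finite (Q : JoinQuery) (I : Q.Input) : (Q.output I).Finite := by
  choose j k hjk using Q.vars_cover
  refine (Set.Finite.pi' (t := fun x => Set.image
      (fun t : Fin (Q.arity (Q.rel (j x))) → ℤ => t (k x)) (I (Q.rel (j x))))
    fun x => Set.Finite.image _ (finite_toSet _)).subset fun x hx v => ?_
  exact ⟨_, hx (j v), by simp [hjk]⟩

/-- A round produces tuples with coordinate `i` at most `h`, the later rounds only tuples with
coordinate at least `h + 1`. -/
theorem tuples_loop_le {B mem : ℕ} {inner : WithBot ℤ → WithTop ℤ → ℕ → Option RunCost}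
    {S : Set (Fin Q.n → ℤ)} (hS : S.Finite) (i : Fin Q.n)
    (hinner : ∀ l h left c, inner l h left = some c →
      c.tuples ≤ {x ∈ S | l ≤ (x i : WithBot ℤ) ∧ (x i : WithTop ℤ) ≤ h}.ncard)
    {low : WithBot ℤ} {pos : Fin Q.m → ℕ} {c : RunCost}
    (hc : Q.loop I B i mem inner low pos = some c) :
    c.tuples ≤ {x ∈ S | low ≤ (x i : WithBot ℤ)}.ncard := by
  refine loop_induction (motive := fun low _ c =>
    c.tuples ≤ {x ∈ S | low ≤ (x i : WithBot ℤ)}.ncard) ?_ ?_ hc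
  · intro low pos left c _ _ hc
    exact (hinner _ _ _ _ hc).trans (Set.ncard_le_ncard (fun x hx => ⟨hx.1, hx.2.1⟩)
      (hS.subset fun x hx => hx.1))
  · intro low pos left c d h _ hs hh hc _ ih
    have hlow := low_lt_of_not_spill hs hh
    refine (add_le_add (hinner _ _ _ _ hc) ih).trans ?_
    rw [← Set.ncard_union_eq ?_ (hS.subset fun x hx => hx.1) (hS.subset fun x hx => hx.1)]
    · refine Set.ncard_le_ncard ?_ (hS.subset fun x hx => hx.1)
      rintro x (hx | hx)
      · exact ⟨hx.1, hx.2.1⟩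
      · exact ⟨hx.1, hlow.le.trans hx.2⟩
    · rw [Set.disjoint_left]
      intro x hx hx'
      have h1 : x i ≤ h := WithTop.coe_le_coe.mp hx.2.2
      have h2 : h + 1 ≤ x i := WithBot.coe_le_coe.mp hx'.2
      omega

/-- Only the bounds of the dimensions already fixed are imposed; the loop lemma is applied to the
set of output tuples that satisfy them. -/
theorem tuples_boxUp_le {B memMax d : ℕ} (hd : d ≤ Q.n) {left : ℕ} {low : ℕ → WithBot ℤ}
    {high : ℕ → WithTop ℤ} {c : RunCost} (hc : Q.boxUp I B memMax d left low high = some c) :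
    c.tuples ≤ {x ∈ Q.output I | ∀ k : Fin Q.n, (k : ℕ) < Q.n - d →
      low k ≤ (x k : WithBot ℤ) ∧ (x k : WithTop ℤ) ≤ high k}.ncard := by
  induction d generalizing left low high c with
  | zero =>
    obtain rfl := Option.some.inj hc
    refine Set.ncard_le_ncard ?_ ((Q.output_finite I).subset fun x hx => hx.1)
    exact fun x hx => ⟨fun j => (mem_filter.mp (hx.2 j)).1, fun k _ => hx.1 k⟩
  | succ d ih =>
    have hi : Q.n - (d + 1) < Q.n := by omega
    rw [boxUp] at hc
    have hfin : {x ∈ Q.output I | ∀ k : Fin Q.n, (k : ℕ) < Q.n - (d + 1) →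
        low k ≤ (x k : WithBot ℤ) ∧ (x k : WithTop ℤ) ≤ high k}.Finite :=
      (Q.output_finite I).subset fun x hx => hx.1
    refine (tuples_loop_le hfin ⟨_, hi⟩ ?_ hc).trans
      (Set.ncard_le_ncard (fun _ hx => hx.1) hfin)
    intro l h left' c' hc'
    refine (ih (by omega) hc').trans (Set.ncard_le_ncard ?_ (hfin.subset fun x hx => hx.1))
    rintro x ⟨hx, hbox⟩
    refine ⟨⟨hx, fun k hk => ?_⟩, ?_⟩
    · have := hbox k (by omega)
      rwa [Function.update_of_ne (by omega), Function.update_of_ne (by omega)] at this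
    · simpa using hbox ⟨_, hi⟩ (by simp; omega)

theorem tuples_boxedRun_le {B memMax : ℕ} {c : RunCost} (hc : Q.boxedRun I B memMax = some c) :
    c.tuples ≤ Q.outputSize I :=
  (tuples_boxUp_le le_rfl hc).trans
    (Set.ncard_le_ncard (fun _ hx => hx.1) (Q.output_finite I))

end JoinQuery

namespace JoinQuery

variable {Q : JoinQuery} {I : Q.Input}

/-! ### The number of blocks read -/

theorem preds_eq_empty {i : ℕ} (hi : Q.rank ≤ i) : Q.preds i = ∅ := by
  rw [preds, filter_eq_empty_iff]
  intro j _ hj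
  have : (Q.firstVar j : ℕ) + 1 ≤ Q.rank :=
    le_sup (f := fun j => (Q.firstVar j : ℕ) + 1) (mem_univ j)
  omega

theorem sum_preds_arity_le (Q : JoinQuery) (i : ℕ) :
    ∑ j ∈ Q.preds i, 3 * Q.arity (Q.rel j) ≤ 3 * Q.totalArity := by
  rw [totalArity, mul_sum]
  exact sum_le_sum_of_subset (subset_univ _)

/-- A nonzero budget of an atom is a constant fraction of the memory for slices. -/
theorem memMax_le_budget {memMax i mem : ℕ} (h1 : memMax / Q.n ≤ mem)
    (h2 : mem ≤ Q.n * (memMax / Q.n)) (hb : mem / #(Q.preds i) ≠ 0) :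
    memMax ≤ 4 * Q.n * Q.m * (mem / #(Q.preds i)) := by
  set b := mem / #(Q.preds i) with hbdef
  have hp : #(Q.preds i) ≤ Q.m := by simpa using card_le_univ (Q.preds i)
  have hp0 : 0 < #(Q.preds i) := Nat.pos_of_ne_zero fun h => hb (by simp [hbdef, h])
  have hn : 0 < Q.n := by
    by_contra h
    have h0 : Q.n = 0 := by omega
    rw [h0, zero_mul] at h2
    exact hb (by simp [hbdef, Nat.le_zero.mp h2])
  have hq : 0 < memMax / Q.n := by
    by_contra h
    have h0 : memMax / Q.n = 0 := Nat.eq_zero_of_not_pos h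
    rw [h0, mul_zero] at h2
    exact hb (by simp [hbdef, Nat.le_zero.mp h2])
  -- Each of the two divisions has a nonzero quotient, so rounding down costs at most a factor `2`;
  -- this gives the `4`.
  calc memMax ≤ Q.n * (memMax / Q.n + 1) := (Nat.lt_mul_div_succ memMax hn).le
    _ ≤ Q.n * (2 * mem) := Nat.mul_le_mul_left _ (by omega)
    _ ≤ Q.n * (2 * (Q.m * (2 * b))) := by
      refine Nat.mul_le_mul_left _ (Nat.mul_le_mul_left _ ?_)
      exact (Nat.lt_mul_div_succ mem hp0).le.trans
        (Nat.mul_le_mul hp (show b + 1 ≤ 2 * b by omega))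
    _ = 4 * Q.n * Q.m * b := by ring

/-- The constant that bounds the number of rounds of a loop. -/
noncomputable def roundConst (Q : JoinQuery) (γ δ : ℝ) : ℝ :=
  2 * (1 / δ + 6 * Q.totalArity) * (1 + 4 * Q.n * Q.m / γ)

theorem roundConst_nonneg (Q : JoinQuery) {γ δ : ℝ} (hγ : 0 < γ) (hδ : 0 < δ) :
    0 ≤ Q.roundConst γ δ := by
  unfold roundConst
  positivity

/-- The first bound controls the blocks that all rounds read themselves, the second the number of
times that the inner dimensions are run. -/
theorem rounds_mul_le {γ δ : ℝ} (hγ : 0 < γ) (hδ : 0 < δ) {B M memMax b N s : ℕ}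
    (hBM : B ≤ M) (hM : memMax * B ≤ M)
    (hγM : γ * M ≤ memMax * B) (hs : δ * M ≤ s) (hb : b ≤ memMax)
    (hb' : b ≠ 0 → memMax ≤ 4 * Q.n * Q.m * b) (hN : N * (b * B) ≤ 6 * Q.totalArity * s)
    (hN' : b = 0 → N = 0) :
    ((N : ℝ) + 1) * (b + 1) * B ≤ Q.roundConst γ δ * s ∧
      ((N : ℝ) + 1) * M ≤ Q.roundConst γ δ * s := by
  have hMs : (M : ℝ) ≤ 1 / δ * s := by
    rw [one_div, ← div_eq_inv_mul, le_div_iff₀ hδ]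
    linarith
  have hBM' : (B : ℝ) ≤ M := by exact_mod_cast hBM
  have hbB : (b : ℝ) * B ≤ M := by exact_mod_cast (Nat.mul_le_mul_right B hb).trans hM
  have hN1 : (N : ℝ) * (b * B) ≤ 6 * Q.totalArity * s := by exact_mod_cast hN
  -- The `N` filled rounds are paid for by the potential; the last one costs at most `M ≤ |I| / δ`.
  have hfull : ((N : ℝ) + 1) * (b * B) ≤ (1 / δ + 6 * Q.totalArity) * s := by
    linarith
  set E : ℝ := (1 / δ + 6 * Q.totalArity) * s with hE
  have hE0 : 0 ≤ E := by positivity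
  have hMs' : (M : ℝ) ≤ E := by
    have : (0 : ℝ) ≤ 6 * Q.totalArity * s := by positivity
    rw [hE]
    linarith
  set F : ℝ := 4 * Q.n * Q.m / γ with hF
  have hF0 : 0 ≤ F := by positivity
  have hD : Q.roundConst γ δ * s = 2 * E + 2 * (F * E) := by
    rw [roundConst]
    ring
  have hFE : 0 ≤ F * E := mul_nonneg hF0 hE0
  rw [hD]
  rcases Nat.eq_zero_or_pos b with h0 | h0
  · have hN0 := hN' h0
    subst h0 hN0
    simp only [Nat.cast_zero, zero_add, one_mul]
    constructor <;> linarith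
  · have hb1 : (1 : ℝ) ≤ b := by exact_mod_cast h0
    have hNB : 0 ≤ ((N : ℝ) + 1) * B := by positivity
    constructor
    · nlinarith
    · have h1 : (memMax : ℝ) ≤ 4 * Q.n * Q.m * b := by exact_mod_cast hb' h0.ne'
      have h2 : (M : ℝ) ≤ F * (b * B) := by
        rw [hF, div_mul_eq_mul_div, le_div_iff₀ hγ]
        have := mul_le_mul_of_nonneg_right h1 (Nat.cast_nonneg (α := ℝ) B)
        linarith
      calc ((N : ℝ) + 1) * M ≤ (N + 1) * (F * (b * B)) :=
            mul_le_mul_of_nonneg_left h2 (by positivity)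
        _ = F * ((N + 1) * (b * B)) := by ring
        _ ≤ F * E := mul_le_mul_of_nonneg_left hfull hF0
        _ ≤ _ := by linarith

theorem reads_loop_le {γ δ : ℝ} (hγ : 0 < γ) (hδ : 0 < δ) {B M memMax i mem : ℕ} (hB : 0 < B)
    (hBM : B ≤ M) (hM : memMax * B ≤ M) (hγM : γ * M ≤ memMax * B)
    (hs : δ * M ≤ Q.inputSize I) (h1 : memMax / Q.n ≤ mem) (h2 : mem ≤ Q.n * (memMax / Q.n))
    {inner : WithBot ℤ → WithTop ℤ → ℕ → Option RunCost} {X : ℝ} (hX0 : 0 ≤ X)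
    (hX : ∀ l h left c, left ≤ mem → inner l h left = some c → (c.reads : ℝ) ≤ X)
    {low : WithBot ℤ} {c : RunCost} (hc : Q.loop I B i mem inner low (fun _ => 0) = some c) :
    (c.reads : ℝ) ≤ 3 * Q.totalArity * Q.roundConst γ δ * (Q.inputSize I / B) +
      Q.roundConst γ δ * (Q.inputSize I / M) * X := by
  obtain ⟨N, hN, hN1, hN2⟩ := exists_rounds (X := ⌊X⌋₊) hB
    (fun l h left c hl hc => Nat.le_floor (hX l h left c hl hc)) hc
  set b := mem / #(Q.preds i) with hb
  obtain ⟨k1, k2⟩ := rounds_mul_le hγ hδ hBM hM hγM hs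
    ((Nat.div_le_self _ _).trans (h2.trans (Nat.mul_div_le _ _)))
    (memMax_le_budget (i := i) h1 h2) hN1 hN2
  have hB' : (0 : ℝ) < B := by exact_mod_cast hB
  have hM' : (0 : ℝ) < M := by exact_mod_cast hB.trans_le hBM
  have hr : ((∑ j ∈ Q.preds i, 3 * Q.arity (Q.rel j) : ℕ) : ℝ) ≤ 3 * Q.totalArity := by
    exact_mod_cast Q.sum_preds_arity_le i
  have hN' : (c.reads : ℝ) ≤ (N + 1) *
      ((∑ j ∈ Q.preds i, 3 * Q.arity (Q.rel j) : ℕ) * (b + 1) + (⌊X⌋₊ : ℕ)) := by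
    exact_mod_cast hN
  have hfl : ((⌊X⌋₊ : ℕ) : ℝ) ≤ X := Nat.floor_le hX0
  have k1' : ((N : ℝ) + 1) * (b + 1) ≤ Q.roundConst γ δ * (Q.inputSize I / B) := by
    rw [← mul_div_assoc, le_div_iff₀ hB']
    exact k1
  have k2' : (N : ℝ) + 1 ≤ Q.roundConst γ δ * (Q.inputSize I / M) := by
    rw [← mul_div_assoc, le_div_iff₀ hM']
    exact k2
  calc (c.reads : ℝ) ≤ (N + 1) * (3 * Q.totalArity * (b + 1) + X) := by
        refine hN'.trans (mul_le_mul_of_nonneg_left (add_le_add ?_ hfl) (by positivity))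
        exact mul_le_mul_of_nonneg_right hr (by positivity)
    _ = 3 * Q.totalArity * ((N + 1) * (b + 1)) + (N + 1) * X := by ring
    _ ≤ 3 * Q.totalArity * (Q.roundConst γ δ * (Q.inputSize I / B)) +
        Q.roundConst γ δ * (Q.inputSize I / M) * X :=
      add_le_add (mul_le_mul_of_nonneg_left k1' (by positivity))
        (mul_le_mul_of_nonneg_right k2' hX0)
    _ = _ := by ring

/-- The constant that bounds the reads in the `k + 1` dimensions up to the rank. -/
noncomputable def readsConst (Q : JoinQuery) (γ δ : ℝ) : ℕ → ℝ
  | 0 => 3 * Q.totalArity * Q.roundConst γ δ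
  | k + 1 => 3 * Q.totalArity * Q.roundConst γ δ / δ ^ (k + 1) +
      Q.roundConst γ δ * Q.readsConst γ δ k

theorem readsConst_nonneg (Q : JoinQuery) {γ δ : ℝ} (hγ : 0 < γ) (hδ : 0 < δ) (k : ℕ) :
    0 ≤ Q.readsConst γ δ k := by
  have := Q.roundConst_nonneg hγ hδ
  induction k with
  | zero => simp only [readsConst]; positivity
  | succ k ih => simp only [readsConst]; positivity

/-- The index `k` is the number of remaining dimensions up to the rank, minus one. The hypothesis on
`left` says that the `Q.n - d` dimensions already treated leave over at most their own shares. -/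
theorem reads_boxUp_le {γ δ : ℝ} (hγ : 0 < γ) (hδ : 0 < δ) {B M memMax : ℕ} (hB : 0 < B)
    (hBM : B ≤ M) (hM : memMax * B ≤ M) (hγM : γ * M ≤ memMax * B)
    (hs : δ * M ≤ Q.inputSize I) {d : ℕ} (hd : d ≤ Q.n) {left : ℕ}
    (hleft : left ≤ (Q.n - d) * (memMax / Q.n)) {low : ℕ → WithBot ℤ}
    {high : ℕ → WithTop ℤ} {c : RunCost} (hc : Q.boxUp I B memMax d left low high = some c) :
    (Q.rank ≤ Q.n - d → c.reads = 0) ∧ ∀ k, Q.n - d + (k + 1) = Q.rank →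
      (c.reads : ℝ) ≤ Q.readsConst γ δ k * (Q.inputSize I / B) * (Q.inputSize I / M) ^ k := by
  have hB' : (0 : ℝ) < B := by exact_mod_cast hB
  have hM' : (0 : ℝ) < M := by exact_mod_cast hB.trans_le hBM
  have hD := Q.roundConst_nonneg hγ hδ
  induction d generalizing left low high c with
  | zero =>
    obtain rfl := Option.some.inj hc
    refine ⟨fun _ => rfl, fun k _ => ?_⟩
    have := Q.readsConst_nonneg hγ hδ k
    simp only [Nat.cast_zero]
    positivity
  | succ d ih =>
    have hi : Q.n - d = Q.n - (d + 1) + 1 := by omega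
    rw [boxUp] at hc
    have hmem : memMax / Q.n + left ≤ (Q.n - d) * (memMax / Q.n) := by
      rw [hi, add_mul, one_mul]
      omega
    have hmem' : memMax / Q.n + left ≤ Q.n * (memMax / Q.n) :=
      hmem.trans (Nat.mul_le_mul_right _ (Nat.sub_le _ _))
    have ih' := fun {left'} (h : left' ≤ memMax / Q.n + left) {low' high' c'} =>
      @ih (by omega) left' (h.trans hmem) low' high' c'
    refine ⟨fun hrank => ?_, fun k hk => ?_⟩
    · obtain ⟨N, hN, -⟩ := exists_rounds (X := 0) hB
        (fun l h left' c' hl hc' => ((ih' hl hc').1 (by omega)).le) hc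
      simpa [preds_eq_empty hrank] using hN
    · cases k with
      | zero =>
        have := reads_loop_le hγ hδ hB hBM hM hγM hs (Nat.le_add_right _ _) hmem' le_rfl
          (fun l h left' c' hl hc' => by simp [(ih' hl hc').1 (by omega)]) hc
        simpa [readsConst] using this
      | succ k =>
        have hE := Q.readsConst_nonneg hγ hδ k
        have := reads_loop_le hγ hδ hB hBM hM hγM hs (Nat.le_add_right _ _) hmem'
          (X := Q.readsConst γ δ k * (Q.inputSize I / B) * (Q.inputSize I / M) ^ k)
          (by positivity) (fun l h left' c' hl hc' => (ih' hl hc').2 k (by omega)) hc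
        refine this.trans ?_
        have hy : δ ≤ (Q.inputSize I : ℝ) / M := (le_div_iff₀ hM').mpr hs
        -- The ratio `|I| / M` may be below `1`, but it is at least `δ`; this explains the power of
        -- `δ` in `readsConst`, which raises the term `|I| / B` to the order of the other one.
        have hy' : 1 ≤ ((Q.inputSize I : ℝ) / M) ^ (k + 1) / δ ^ (k + 1) :=
          (one_le_div (by positivity)).mpr (pow_le_pow_left₀ hδ.le hy _)
        have h0 : 0 ≤ 3 * Q.totalArity * Q.roundConst γ δ * ((Q.inputSize I : ℝ) / B) := by
          positivity
        calc _ ≤ 3 * Q.totalArity * Q.roundConst γ δ * ((Q.inputSize I : ℝ) / B) *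
              (((Q.inputSize I : ℝ) / M) ^ (k + 1) / δ ^ (k + 1)) + _ :=
              add_le_add_left (le_mul_of_one_le_right h0 hy') _
          _ = _ := by rw [readsConst, pow_succ ((Q.inputSize I : ℝ) / M)]; ring

/-- A relation symbol exists and is mentioned by some atom. This keeps `Q.rank - 1` from being
truncated. -/
theorem rank_pos_of_inputSize_pos (h : 0 < Q.inputSize I) : 0 < Q.rank := by
  obtain ⟨r, -, -⟩ := exists_ne_zero_of_sum_ne_zero h.ne'
  obtain ⟨j, -⟩ := Q.rel_surjective r
  exact (Nat.succ_pos _).trans_le (le_sup (f := fun j => (Q.firstVar j : ℕ) + 1) (mem_univ j))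

theorem reads_boxedRun_le {γ δ : ℝ} (hγ : 0 < γ) (hδ : 0 < δ) {B M memMax : ℕ} (hB : 0 < B)
    (hBM : B ≤ M) (hM : memMax * B ≤ M) (hγM : γ * M ≤ memMax * B)
    (hs : δ * M ≤ Q.inputSize I) (hrank : 0 < Q.rank) {c : RunCost}
    (hc : Q.boxedRun I B memMax = some c) :
    (c.reads : ℝ) ≤ Q.readsConst γ δ (Q.rank - 1) * (Q.inputSize I / B) *
      (Q.inputSize I / M) ^ (Q.rank - 1) :=
  (reads_boxUp_le hγ hδ hB hBM hM hγM hs le_rfl (Nat.zero_le _) hc).2 _ (by omega)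

end JoinQuery

/-! ### Output writes and the final bound -/

theorem RunCost.io_le (c : RunCost) {B : ℕ} (hB : 0 < B) (n : ℕ) :
    (c.io B n : ℝ) ≤ c.reads + n * (c.tuples / B) + 1 := by
  have hB' : (0 : ℝ) < B := by exact_mod_cast hB
  have h1 : (((n * c.tuples + B - 1) / B : ℕ) : ℝ) ≤ n * (c.tuples / B) + 1 := by
    refine Nat.cast_div_le.trans ?_
    rw [div_le_iff₀ hB']
    have h2 : ((n * c.tuples + B - 1 : ℕ) : ℝ) ≤ n * c.tuples + B := by
      exact_mod_cast Nat.sub_le _ _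
    calc _ ≤ (n : ℝ) * c.tuples + B := h2
      _ = _ := by field_simp
  rw [io, Nat.cast_add]
  linarith

/-- The I/O cost of a run of boxed Leapfrog Triejoin without spills.  `Q` is the query (with its key
order), `M` the size of the main memory in words, `B` the size of a block, and `memMax` the number
of blocks of main memory that are used for slices, a constant fraction of the main memory. -/
theorem mainTheorem4 (Q : JoinQuery) (γ δ : ℝ) (hγ : 0 < γ) (hδ : 0 < δ) :
    ∃ C : ℝ, ∀ (B M memMax : ℕ) (I : Q.Input) (c : RunCost),
      0 < B → B ≤ M →
      memMax * B ≤ M → γ * M ≤ memMax * B →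
      δ * M ≤ Q.inputSize I →
      Q.boxedRun I B memMax = some c →
      (c.io B Q.n : ℝ) ≤
        C * ((Q.inputSize I : ℝ) ^ Q.rank / ((M : ℝ) ^ (Q.rank - 1) * B) +
          (Q.outputSize I : ℝ) / B) := by
  -- The summands pay for the reads, for the partly filled last output block, and for the `n` words
  -- of each output tuple.
  refine ⟨Q.readsConst γ δ (Q.rank - 1) + 1 / δ ^ Q.rank + Q.n, ?_⟩
  intro B M memMax I c hB hBM hM hγM hs hc
  have hB' : (0 : ℝ) < B := by exact_mod_cast hB
  have hBM' : (B : ℝ) ≤ M := by exact_mod_cast hBM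
  have hM' : (0 : ℝ) < M := hB'.trans_le hBM'
  have hs0 : 0 < Q.inputSize I := by exact_mod_cast (mul_pos hδ hM').trans_le hs
  obtain ⟨k, hk⟩ : ∃ k, Q.rank = k + 1 :=
    ⟨Q.rank - 1, by have := JoinQuery.rank_pos_of_inputSize_pos hs0; omega⟩
  have hreads := JoinQuery.reads_boxedRun_le hγ hδ hB hBM hM hγM hs (by omega) hc
  have htuples : (c.tuples : ℝ) / B ≤ Q.outputSize I / B :=
    div_le_div_of_nonneg_right (by exact_mod_cast JoinQuery.tuples_boxedRun_le hc) hB'.le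
  have hE := Q.readsConst_nonneg hγ hδ (Q.rank - 1)
  rw [hk, Nat.add_sub_cancel] at *
  set s : ℝ := (Q.inputSize I : ℝ)
  have hsplit : s / B * (s / M) ^ k = s ^ (k + 1) / ((M : ℝ) ^ k * B) := by
    rw [div_pow, pow_succ]
    field_simp
  -- Both `|I| / B` and `|I| / M` are at least `δ`, because `B ≤ M`.
  have hone : 1 ≤ 1 / δ ^ (k + 1) * (s ^ (k + 1) / ((M : ℝ) ^ k * B)) := by
    rw [← hsplit, one_div_mul_eq_div, one_le_div (by positivity), pow_succ, mul_comm]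
    refine mul_le_mul ?_ (pow_le_pow_left₀ hδ.le ((le_div_iff₀ hM').mpr hs) k) (by positivity)
      (by positivity)
    rw [le_div_iff₀ hB']
    exact (mul_le_mul_of_nonneg_left hBM' hδ.le).trans hs
  set Y := s ^ (k + 1) / ((M : ℝ) ^ k * B)
  have hY0 : 0 ≤ Y := by positivity
  rw [mul_assoc, hsplit] at hreads
  have hio := c.io_le hB Q.n
  have h1 : (Q.n : ℝ) * (c.tuples / B) ≤ Q.n * (Q.outputSize I / B) :=
    mul_le_mul_of_nonneg_left htuples (by positivity)
  have h2 : 0 ≤ (Q.readsConst γ δ k + 1 / δ ^ (k + 1)) * ((Q.outputSize I : ℝ) / B) := by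
    positivity
  have h3 : 0 ≤ (Q.n : ℝ) * Y := by positivity
  calc (c.io B Q.n : ℝ) ≤ Q.readsConst γ δ k * Y + Q.n * (Q.outputSize I / B) +
        1 / δ ^ (k + 1) * Y := by linarith
    _ ≤ _ := by linarith
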